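/- Let $(X,d)$ be a compact metric space and let $f\colon X\to X$ be continuous. A pair $(x,y)\in X\times X$ is a Li–Yorke pair of $f$ if $\liminf_{n\to\infty} d(f^n(x),f^n(y))=0$ and $\limsup_{n\to\infty} d(f^n(x),f^n(y))>0$, and $f$ is called densely chaotic if the set of its Li–Yorke pairs is dense in $X\times X$. Let $\mathcal K(X)$ be the space of all non-empty compact subsets of $X$ with the Hausdorff metric $d_H$ (again a compact metric space), and let $\overline f\colon\mathcal K(X)\to\mathcal K(X)$, $\overline f(K)=f(K)=\{f(x) : x\in K\}$, be the continuous map induced by $f$. **Theorem.** Let $I=[0,1]$ and let $f\colon I\to I$ be continuous. If $f$ is densely chaotic, then the induced map $\overline f\colon\mathcal K(I)\to\mathcal K(I)$ is densely chaotic. -/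

import Mathlib

open Filter Topology TopologicalSpace

/-- `C₁(f)`: the pairs `(x, y)` with `liminf d(fⁿ x, fⁿ y) = 0`. The space is compact, so the real
sequence is bounded and `liminf` and `limsup` have their usual meaning. -/
def proximalPairs {X : Type*} [MetricSpace X] [CompactSpace X] (f : C(X, X)) : Set (X × X) :=
  {p | liminf (fun n : ℕ => dist (f^[n] p.1) (f^[n] p.2)) atTop = 0}

/-- `C₂(f)`: the pairs `(x, y)` with `limsup d(fⁿ x, fⁿ y) > 0`. -/
def nonAsymptoticPairs {X : Type*} [MetricSpace X] [CompactSpace X] (f : C(X, X)) : Set (X × X) :=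
  {p | 0 < limsup (fun n : ℕ => dist (f^[n] p.1) (f^[n] p.2)) atTop}

/-- `C(f) = C₁(f) ∩ C₂(f)`: the set of Li–Yorke pairs of `f`. -/
def liYorkePairs {X : Type*} [MetricSpace X] [CompactSpace X] (f : C(X, X)) : Set (X × X) :=
  proximalPairs f ∩ nonAsymptoticPairs f

/-- `f` is densely chaotic if its Li–Yorke pairs are dense in `X × X`. -/
def DenselyChaotic {X : Type*} [MetricSpace X] [CompactSpace X] (f : C(X, X)) : Prop :=
  Dense (liYorkePairs f)

/-- The map `K ↦ f(K)` induced by `f` on the space of nonempty compact subsets of `X`, which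
carries the Hausdorff metric. -/
def inducedMap {X : Type*} [MetricSpace X] [CompactSpace X] (f : C(X, X)) :
    C(NonemptyCompacts X, NonemptyCompacts X) where
  toFun K := K.map f f.continuous
  continuous_toFun := f.continuous.nonemptyCompacts_map

/-! Density of Li–Yorke pairs means that any two nondegenerate intervals `J`, `K` contain a Li–Yorke
pair with one member in each. In an ordered space this forces a fixed point `z` such that every
neighbourhood of `z` meets all but finitely many images of each nondegenerate interval
(`exists_fixedPt_eventually_mem_nhds`): the return sets of intervals are compact order-convex sets,
pairwise intersecting and mapped into themselves, so they share an invariant closed interval and a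
fixed point in it; connectedness then upgrades "infinitely often" to "eventually". Hence finitely
many intervals come near `z` at the same time.

Replace the two given compact sets by finite nets with a ball around each net point. If some ball
contains an open set all of whose subintervals have images of diameter at least a common `δ`
infinitely often, a Baire-generic tuple of points is simultaneously proximal to `z` while one orbit
is often far from all others (`exists_proximal_separated_tuple`). Otherwise each ball contains a
point asymptotic to `z` (`exists_mem_tendsto_iterate`), and adjoining the members of a Li–Yorke pair
of `f` to such points suffices. -/

/-! ### From infinitely many returns to eventual nearness -/

section OrderDynamics

variable {X : Type*} [CompleteLinearOrder X] [TopologicalSpace X] [OrderTopology X]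
  [DenselyOrdered X]

/-- If every nondegenerate interval returns arbitrarily close to the fixed point `z` and an image of
`L` contains a fixed point `w > z`, then the images of `L` eventually reach below any `c > z`. -/
theorem eventually_exists_iterate_lt_of_fixedPt {g : X → X} (hg : Continuous g) {z c : X}
    (hz : g z = z) (hzc : z < c)
    (hrec : ∀ J : Set X, IsPreconnected J → J.Nontrivial → ∀ d > z,
      ∃ᶠ k in atTop, ∃ x ∈ J, g^[k] x < d)
    {L : Set X} (hL : IsPreconnected L) (hLn : L.Nontrivial) {w : X} (hzw : z < w) (hw : g w = w)
    {k₀ : ℕ} (hk₀ : ∃ x ∈ L, g^[k₀] x = w) :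
    ∀ᶠ k in atTop, ∃ x ∈ L, g^[k] x < c := by
  have hwit : ∀ k, g^[k] w = w := fun k => Function.iterate_fixed hw k
  have hzit : ∀ k, g^[k] z = z := fun k => Function.iterate_fixed hz k
  have hmem : ∀ k ≥ k₀, w ∈ g^[k] '' L := by
    intro k hk
    obtain ⟨x, hx, hxw⟩ := hk₀
    refine ⟨x, hx, ?_⟩
    obtain ⟨j, rfl⟩ := Nat.exists_eq_add_of_le hk
    rw [add_comm, Function.iterate_add_apply, hxw, hwit]
  have hpre : ∀ k, (g^[k] '' L).OrdConnected := fun k =>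
    (hL.image _ (hg.iterate k).continuousOn).ordConnected
  obtain ⟨d, hzd, hd⟩ := exists_between (lt_min hzc hzw)
  have hdc : d < c := hd.trans_le (min_le_left _ _)
  have hdw : d < w := hd.trans_le (min_le_right _ _)
  -- `[d, w]` covers itself after `r` steps
  obtain ⟨r, hr1, hr⟩ : ∃ r ≥ 1, Set.Icc d w ⊆ g^[r] '' Set.Icc d w := by
    have hf := hrec (Set.Icc d w) isPreconnected_Icc
      ⟨d, ⟨le_rfl, hdw.le⟩, w, ⟨hdw.le, le_rfl⟩, hdw.ne⟩ d hzd
    obtain ⟨r, hr1, x, hx, hxd⟩ := (frequently_atTop.1 hf) 1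
    refine ⟨r, hr1, ?_⟩
    have hoc : (g^[r] '' Set.Icc d w).OrdConnected :=
      (isPreconnected_Icc.image _ (hg.iterate r).continuousOn).ordConnected
    exact (Set.Icc_subset_Icc_left hxd.le).trans
      (hoc.out ⟨x, hx, rfl⟩ ⟨w, ⟨hdw.le, le_rfl⟩, hwit r⟩)
  -- Starting in `(z, e)`, a point stays below `d` for `r` consecutive times; these are the base
  -- cases of the induction with step `r`.
  obtain ⟨e, hze, he⟩ : ∃ e > z, ∀ x, z < x → x < e → ∀ j < r, g^[j] x < d := by
    have h : ∀ᶠ x in 𝓝[>] z, ∀ j ∈ Finset.range r, g^[j] x < d := by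
      refine (Finset.eventually_all _).2 fun j _ => ?_
      have : Tendsto (g^[j]) (𝓝 z) (𝓝 z) := by
        simpa [hzit] using (hg.iterate j).tendsto z
      exact (this.eventually_lt_const hzd).filter_mono nhdsWithin_le_nhds
    obtain ⟨e, hze, he⟩ := (mem_nhdsGT_iff_exists_Ioo_subset' hzc).1 h
    exact ⟨e, hze, fun x h1 h2 j hj => he ⟨h1, h2⟩ j (Finset.mem_range.2 hj)⟩
  by_cases hside : ∀ k ≥ k₀, ∀ x ∈ L, z < g^[k] x
  · obtain ⟨m, hm, x, hx, hxe⟩ := (frequently_atTop.1 (hrec L hL hLn e hze)) k₀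
    have hcov : ∀ j, Set.Icc d w ⊆ g^[m + j] '' L := by
      intro j
      induction j using Nat.strong_induction_on with
      | _ j ih =>
        rcases lt_or_ge j r with hj | hj
        · have h1 := he _ (hside m hm x hx) hxe j hj
          refine (Set.Icc_subset_Icc_left h1.le).trans
            ((hpre (m + j)).out ⟨x, hx, ?_⟩ (hmem _ (by omega)))
          rw [add_comm, Function.iterate_add_apply]
        · obtain ⟨i, rfl⟩ := Nat.exists_eq_add_of_le hj
          refine hr.trans ((Set.image_mono (ih i (by omega))).trans ?_)
          rw [← Set.image_comp, ← Function.iterate_add, show r + (m + i) = m + (r + i) by ring]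
    filter_upwards [eventually_ge_atTop m] with k hk
    obtain ⟨j, rfl⟩ := Nat.exists_eq_add_of_le hk
    obtain ⟨y, hy, hyd⟩ := hcov j ⟨le_rfl, hdw.le⟩
    exact ⟨y, hy, hyd ▸ hdc⟩
  · push Not at hside
    obtain ⟨k, hk, x, hx, hxz⟩ := hside
    obtain ⟨y, hy, hyz⟩ := (hpre k).out ⟨x, hx, rfl⟩ (hmem k hk) ⟨hxz, hzw.le⟩
    filter_upwards [eventually_ge_atTop k] with m hm
    obtain ⟨j, rfl⟩ := Nat.exists_eq_add_of_le hm
    refine ⟨y, hy, ?_⟩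
    rwa [add_comm, Function.iterate_add_apply, hyz, hzit]

/-- Since `L` meets `g '' L`, the union of the images is connected. Without a fixed point in it, `g
y - y` has constant sign, so to speak: if orbits decrease, a point once below `c` stays there; if
they increase, the part of `L` above `a` can never return below `a`. -/
theorem eventually_exists_iterate_lt {g : X → X} (hg : Continuous g) {z c : X}
    (hz : g z = z) (hzc : z < c)
    (hrec : ∀ J : Set X, IsPreconnected J → J.Nontrivial → ∀ d > z,
      ∃ᶠ k in atTop, ∃ x ∈ J, g^[k] x < d)
    {L : Set X} (hL : IsPreconnected L) (hLn : L.Nontrivial) (hchain : ∃ x ∈ L, g x ∈ L)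
    (hside : ∀ k, ∀ x ∈ L, z < g^[k] x) :
    ∀ᶠ k in atTop, ∃ x ∈ L, g^[k] x < c := by
  by_cases hfix : ∃ k, ∃ x ∈ L, g (g^[k] x) = g^[k] x
  · obtain ⟨k, x, hx, hfx⟩ := hfix
    exact eventually_exists_iterate_lt_of_fixedPt hg hz hzc hrec hL hLn (hside k x hx) hfx
      ⟨x, hx, rfl⟩
  push Not at hfix
  have hU : IsPreconnected (⋃ k, g^[k] '' L) := by
    refine IsPreconnected.iUnion_of_chain
      (fun k => hL.image _ (hg.iterate k).continuousOn) fun k => ?_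
    obtain ⟨x, hx, hgx⟩ := hchain
    refine ⟨g^[k] (g x), ⟨g x, hgx, rfl⟩, ⟨x, hx, ?_⟩⟩
    rw [Nat.succ_eq_succ, Function.iterate_succ_apply]
  have hmemU : ∀ k, ∀ x ∈ L, g^[k] x ∈ ⋃ k, g^[k] '' L := fun k x hx =>
    Set.mem_iUnion.2 ⟨k, x, hx, rfl⟩
  obtain ⟨x₀, hx₀⟩ := hLn.nonempty
  have hne : ∀ y ∈ ⋃ k, g^[k] '' L, g y ≠ y := by
    rintro y hy
    obtain ⟨k, x, hx, rfl⟩ := Set.mem_iUnion.1 hy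
    exact hfix k x hx
  rcases lt_or_gt_of_ne (hne x₀ (hmemU 0 x₀ hx₀)) with h0 | h0
  · have hdec : ∀ y ∈ ⋃ k, g^[k] '' L, g y < y := by
      intro y hy
      by_contra! hcon
      obtain ⟨u, hu, hgu⟩ := hU.intermediate_value₂ (hmemU 0 x₀ hx₀) hy hg.continuousOn
        continuous_id.continuousOn h0.le hcon
      exact hne u hu hgu
    obtain ⟨k, -, x, hx, hxc⟩ := (frequently_atTop.1 (hrec L hL hLn c hzc)) 0
    filter_upwards [eventually_ge_atTop k] with m hm
    refine ⟨x, hx, ?_⟩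
    induction m, hm using Nat.le_induction with
    | base => exact hxc
    | succ m _ ih =>
      rw [Function.iterate_succ_apply']
      exact (hdec _ (hmemU m x hx)).trans ih
  · have hinc : ∀ y ∈ ⋃ k, g^[k] '' L, y < g y := by
      intro y hy
      by_contra! hcon
      obtain ⟨u, hu, hgu⟩ := hU.intermediate_value₂ hy (hmemU 0 x₀ hx₀) hg.continuousOn
        continuous_id.continuousOn hcon h0.le
      exact hne u hu hgu
    exfalso
    obtain ⟨a, ha, b, hb, hab⟩ := hLn.exists_lt
    -- the subinterval of `L` above `a` never gets below `a`
    obtain ⟨k, -, x, ⟨hx, hax⟩, hxa⟩ := (frequently_atTop.1 (hrec (L ∩ Set.Ici a)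
      ((hL.ordConnected.inter Set.ordConnected_Ici).isPreconnected)
      ⟨a, ⟨ha, le_rfl⟩, b, ⟨hb, hab.le⟩, hab.ne⟩ a (hside 0 a ha))) 0
    have : ∀ m, x ≤ g^[m] x := by
      intro m
      induction m with
      | zero => exact le_rfl
      | succ m ih =>
        rw [Function.iterate_succ_apply']
        exact ih.trans (hinc _ (hmemU m x hx)).le
    exact absurd (hxa.trans_le (Set.mem_Ici.1 hax)) (this k).not_gt

/-- Order dual, for images lying below `z`. -/
theorem eventually_exists_iterate_gt {g : X → X} (hg : Continuous g) {z c : X}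
    (hz : g z = z) (hzc : c < z)
    (hrec : ∀ J : Set X, IsPreconnected J → J.Nontrivial → ∀ d < z,
      ∃ᶠ k in atTop, ∃ x ∈ J, d < g^[k] x)
    {L : Set X} (hL : IsPreconnected L) (hLn : L.Nontrivial) (hchain : ∃ x ∈ L, g x ∈ L)
    (hside : ∀ k, ∀ x ∈ L, g^[k] x < z) :
    ∀ᶠ k in atTop, ∃ x ∈ L, c < g^[k] x :=
  eventually_exists_iterate_lt (X := Xᵒᵈ) hg hz hzc hrec hL hLn hchain hside

/-- Let `z` be a fixed point to which every nondegenerate interval returns. If the images of every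
nondegenerate interval are nondegenerate and two of them meet, then every nondegenerate interval
converges to `z`, in the sense that its images eventually meet every neighbourhood of `z`. -/
theorem eventually_exists_iterate_mem_nhds {f : X → X} (hf : Continuous f) {z : X} (hz : f z = z)
    (hrec : ∀ J : Set X, IsPreconnected J → J.Nontrivial → ∀ U ∈ 𝓝 z,
      ∃ᶠ n in atTop, ∃ x ∈ J, f^[n] x ∈ U)
    (hnt : ∀ J : Set X, IsPreconnected J → J.Nontrivial → ∀ n, (f^[n] '' J).Nontrivial)
    (hret : ∀ J : Set X, IsPreconnected J → J.Nontrivial →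
      ∃ n p, 0 < p ∧ ∃ x ∈ J, ∃ y ∈ J, f^[n] x = f^[n + p] y)
    {J : Set X} (hJ : IsPreconnected J) (hJn : J.Nontrivial) {U : Set X} (hU : U ∈ 𝓝 z) :
    ∀ᶠ n in atTop, ∃ x ∈ J, f^[n] x ∈ U := by
  have hzit : ∀ k, f^[k] z = z := fun k => Function.iterate_fixed hz k
  by_cases hz0 : ∃ n, ∃ x ∈ J, f^[n] x = z
  · obtain ⟨n, x, hx, hxz⟩ := hz0
    filter_upwards [eventually_ge_atTop n] with m hm
    obtain ⟨j, rfl⟩ := Nat.exists_eq_add_of_le hm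
    refine ⟨x, hx, ?_⟩
    rw [add_comm, Function.iterate_add_apply, hxz, hzit]
    exact mem_of_mem_nhds hU
  push Not at hz0
  -- Two images of `J` that meet make `L` meet `g '' L`, so the images of `L` under powers of `g`
  -- unite to an interval; it misses `z` and lies on one side of it.
  obtain ⟨n₀, p, hp, x₀, hx₀, y₀, hy₀, hxy⟩ := hret J hJ hJn
  set L := f^[n₀] '' J
  set g := f^[p]
  have hg : Continuous g := hf.iterate p
  have hgit : ∀ k, g^[k] = f^[p * k] := fun k => (Function.iterate_mul f p k).symm
  have hL : IsPreconnected L := hJ.image _ (hf.iterate n₀).continuousOn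
  have hLn : L.Nontrivial := hnt J hJ hJn n₀
  have hchain : ∃ x ∈ L, g x ∈ L := by
    refine ⟨f^[n₀] y₀, ⟨y₀, hy₀, rfl⟩, x₀, hx₀, ?_⟩
    rw [hxy, add_comm, Function.iterate_add_apply]
  have hnz : ∀ k, ∀ x ∈ L, g^[k] x ≠ z := by
    rintro k _ ⟨x, hx, rfl⟩
    rw [hgit, ← Function.iterate_add_apply]
    exact hz0 _ x hx
  -- returning along multiples of `p`
  have hrecg : ∀ J : Set X, IsPreconnected J → J.Nontrivial → ∀ U ∈ 𝓝 z,
      ∃ᶠ k in atTop, ∃ x ∈ J, g^[k] x ∈ U := by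
    intro J hJ hJn U hU
    -- A return at time `n` is carried on to the next multiple of `p`, which takes `p - n % p ≤ p`
    -- steps.
    have hV : ∀ᶠ x in 𝓝 z, ∀ j ∈ Finset.range (p + 1), f^[j] x ∈ U := by
      refine (Finset.eventually_all _).2 fun j _ => ?_
      have : Tendsto (f^[j]) (𝓝 z) (𝓝 z) := by
        simpa [hzit] using (hf.iterate j).tendsto z
      exact this hU
    rw [frequently_atTop]
    intro K
    obtain ⟨n, hn, x, hx, hxV⟩ := (frequently_atTop.1 (hrec J hJ hJn _ hV)) (p * K)
    refine ⟨n / p + 1, ?_, x, hx, ?_⟩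
    · have : K ≤ n / p := (Nat.le_div_iff_mul_le hp).2 (by rw [mul_comm]; exact hn)
      omega
    · have h1 := Nat.div_add_mod n p
      have h2 := Nat.mod_lt n hp
      have h3 : p * (n / p + 1) = (p - n % p) + n := by
        rw [mul_add, mul_one]; omega
      rw [hgit, h3, Function.iterate_add_apply]
      exact hxV _ (Finset.mem_range.2 (by omega))
  have hgz : g z = z := hzit p
  have hUpre : (⋃ k, g^[k] '' L).OrdConnected := by
    refine (IsPreconnected.iUnion_of_chain
      (fun k => hL.image _ (hg.iterate k).continuousOn) fun k => ?_).ordConnected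
    obtain ⟨x, hx, hgx⟩ := hchain
    refine ⟨g^[k] (g x), ⟨g x, hgx, rfl⟩, ⟨x, hx, ?_⟩⟩
    rw [Nat.succ_eq_succ, Function.iterate_succ_apply]
  have hmemU : ∀ k, ∀ x ∈ L, g^[k] x ∈ ⋃ k, g^[k] '' L := fun k x hx =>
    Set.mem_iUnion.2 ⟨k, x, hx, rfl⟩
  have hznot : z ∉ ⋃ k, g^[k] '' L := by
    intro h
    obtain ⟨k, x, hx, hxz⟩ := Set.mem_iUnion.1 h
    exact hnz k x hx hxz
  have key : ∀ V ∈ 𝓝 z, ∀ᶠ k in atTop, ∃ x ∈ L, g^[k] x ∈ V := by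
    intro V hV
    obtain ⟨x₁, hx₁⟩ := hLn.nonempty
    rcases lt_or_gt_of_ne (hnz 0 x₁ hx₁) with h1 | h1
    · have hside : ∀ k, ∀ x ∈ L, g^[k] x < z := by
        intro k x hx
        by_contra! hcon
        exact hznot (hUpre.out (hmemU 0 x₁ hx₁) (hmemU k x hx) ⟨h1.le, hcon⟩)
      obtain ⟨c, hc, hcV⟩ := exists_Ioc_subset_of_mem_nhds hV ⟨x₁, h1⟩
      filter_upwards [eventually_exists_iterate_gt hg hgz hc
        (fun J hJ hJn d hd => hrecg J hJ hJn _ (Ioi_mem_nhds hd)) hL hLn hchain hside]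
        with k ⟨x, hx, hxc⟩
      exact ⟨x, hx, hcV ⟨hxc, (hside k x hx).le⟩⟩
    · have hside : ∀ k, ∀ x ∈ L, z < g^[k] x := by
        intro k x hx
        by_contra! hcon
        exact hznot (hUpre.out (hmemU k x hx) (hmemU 0 x₁ hx₁) ⟨hcon, h1.le⟩)
      obtain ⟨c, hc, hcV⟩ := exists_Ico_subset_of_mem_nhds hV ⟨x₁, h1⟩
      filter_upwards [eventually_exists_iterate_lt hg hgz hc
        (fun J hJ hJn d hd => hrecg J hJ hJn _ (Iio_mem_nhds hd)) hL hLn hchain hside]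
        with k ⟨x, hx, hxc⟩
      exact ⟨x, hx, hcV ⟨(hside k x hx).le, hxc⟩⟩
  have hV : ∀ᶠ x in 𝓝 z, ∀ j ∈ Finset.range p, f^[j] x ∈ U := by
    refine (Finset.eventually_all _).2 fun j _ => ?_
    have : Tendsto (f^[j]) (𝓝 z) (𝓝 z) := by
      simpa [hzit] using (hf.iterate j).tendsto z
    exact this hU
  obtain ⟨K, hK⟩ := eventually_atTop.1 (key _ hV)
  filter_upwards [eventually_ge_atTop (n₀ + p * K)] with n hn
  obtain ⟨m, rfl⟩ := Nat.exists_eq_add_of_le (show n₀ ≤ n by omega)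
  have hmK : K ≤ m / p := (Nat.le_div_iff_mul_le hp).2 (by rw [mul_comm]; omega)
  obtain ⟨_, ⟨x, hx, rfl⟩, hxV⟩ := hK _ hmK
  refine ⟨x, hx, ?_⟩
  have h1 := Nat.div_add_mod m p
  have h2 := hxV _ (Finset.mem_range.2 (Nat.mod_lt m hp))
  rw [hgit, ← Function.iterate_add_apply, ← Function.iterate_add_apply] at h2
  rw [show n₀ + m = m % p + p * (m / p) + n₀ by omega]
  exact h2

end OrderDynamics

/-! ### Return sets -/

section ReturnSet

variable {X : Type*} [TopologicalSpace X]

/-- The points every neighbourhood of which is met by infinitely many images of `J`. -/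
def returnSet (f : X → X) (J : Set X) : Set X :=
  {x | ∀ U ∈ 𝓝 x, ∃ᶠ n in atTop, ∃ y ∈ J, f^[n] y ∈ U}

theorem isClosed_returnSet (f : X → X) (J : Set X) : IsClosed (returnSet f J) := by
  rw [← isOpen_compl_iff, isOpen_iff_mem_nhds]
  intro x hx
  simp only [returnSet, Set.mem_compl_iff, Set.mem_ofPred_eq, not_forall] at hx
  obtain ⟨U, hU, hn⟩ := hx
  filter_upwards [eventually_mem_nhds_iff.2 hU] with y hy hyD
  exact hn (hyD U hy)

theorem mapsTo_returnSet {f : X → X} (hf : Continuous f) (J : Set X) :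
    Set.MapsTo f (returnSet f J) (returnSet f J) := by
  intro x hx U hU
  rw [frequently_atTop]
  intro N
  obtain ⟨n, hn, y, hy, hyU⟩ := (frequently_atTop.1 (hx _ (hf.continuousAt hU))) N
  exact ⟨n + 1, by omega, y, hy, by rwa [Function.iterate_succ_apply']⟩

end ReturnSet

/-! ### Consequences of proximality and non-asymptoticity -/

section Iterates

variable {X : Type*} [MetricSpace X] {f : X → X}

theorem image_iterate_nontrivial {J : Set X}
    (h : ∃ x ∈ J, ∃ y ∈ J, ∃ ε > 0, ∃ᶠ n in atTop, ε < dist (f^[n] x) (f^[n] y)) (n : ℕ) :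
    (f^[n] '' J).Nontrivial := by
  obtain ⟨x, hx, y, hy, ε, hε, hxy⟩ := h
  refine ⟨_, ⟨x, hx, rfl⟩, _, ⟨y, hy, rfl⟩, fun heq => ?_⟩
  obtain ⟨m, hm, hlt⟩ := (frequently_atTop.1 hxy) n
  obtain ⟨j, rfl⟩ := Nat.exists_eq_add_of_le hm
  rw [add_comm, Function.iterate_add_apply, Function.iterate_add_apply, heq, dist_self] at hlt
  linarith

variable [CompactSpace X]

/-- A proximal pair of `f` is proximal along every progression `p k`. -/
theorem frequently_dist_iterate_mul_lt (hf : Continuous f) {x y : X}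
    (h : ∀ ε > 0, ∃ᶠ n in atTop, dist (f^[n] x) (f^[n] y) < ε) {p : ℕ} (hp : 0 < p)
    {ε : ℝ} (hε : 0 < ε) : ∃ᶠ k in atTop, dist (f^[p * k] x) (f^[p * k] y) < ε := by
  have huc : ∀ᶠ q : X × X in uniformity X, ∀ j ∈ Finset.range (p + 1),
      dist (f^[j] q.1) (f^[j] q.2) < ε := by
    refine (Finset.eventually_all _).2 fun j _ => ?_
    exact CompactSpace.uniformContinuous_of_continuous (hf.iterate j)
      (Metric.dist_mem_uniformity hε)
  obtain ⟨η, hη, hq⟩ := Metric.mem_uniformity_dist.1 huc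
  rw [frequently_atTop]
  intro K
  obtain ⟨n, hn, hxy⟩ := (frequently_atTop.1 (h η hη)) (p * K)
  refine ⟨n / p + 1, ?_, ?_⟩
  · have : K ≤ n / p := (Nat.le_div_iff_mul_le hp).2 (by rw [mul_comm]; exact hn)
    omega
  · have h1 := Nat.div_add_mod n p
    have h2 := Nat.mod_lt n hp
    have h3 : p * (n / p + 1) = (p - n % p) + n := by
      rw [mul_add, mul_one]; omega
    rw [h3, Function.iterate_add_apply, Function.iterate_add_apply]
    exact hq hxy _ (Finset.mem_range.2 (by omega))

/-- Two sets containing a common proximal pair have a common return point. -/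
theorem returnSet_inter_nonempty {J K : Set X}
    (h : ∃ x ∈ J, ∃ y ∈ K, ∀ ε > 0, ∃ᶠ n in atTop, dist (f^[n] x) (f^[n] y) < ε) :
    (returnSet f J ∩ returnSet f K).Nonempty := by
  obtain ⟨x, hx, y, hy, hxy⟩ := h
  choose φ hφ hφd using fun k : ℕ =>
    (frequently_atTop.1 (hxy (1 / ((k : ℝ) + 1)) Nat.one_div_pos_of_nat)) k
  -- Along times when the two orbits approach each other, a limit point of one is a limit point of
  -- the other.
  obtain ⟨a, -, ψ, hψ, ha⟩ := isCompact_univ.tendsto_subseq (fun k => Set.mem_univ (f^[φ k] x))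
  have hφt : Tendsto φ atTop atTop := tendsto_atTop_mono hφ tendsto_id
  have hdist : Tendsto (fun k => dist (f^[φ (ψ k)] x) (f^[φ (ψ k)] y)) atTop (𝓝 0) := by
    refine squeeze_zero (fun _ => dist_nonneg) (fun k => (hφd (ψ k)).le) ?_
    exact (tendsto_one_div_add_atTop_nhds_zero_nat (𝕜 := ℝ)).comp hψ.tendsto_atTop
  have hb : Tendsto (fun k => f^[φ (ψ k)] y) atTop (𝓝 a) :=
    (tendsto_iff_of_dist hdist).1 ha
  refine ⟨a, fun U hU => ?_, fun U hU => ?_⟩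
  · exact (hφt.comp hψ.tendsto_atTop).frequently
      (Eventually.frequently ((ha.eventually hU).mono fun k hk => ⟨x, hx, hk⟩))
  · exact (hφt.comp hψ.tendsto_atTop).frequently
      (Eventually.frequently ((hb.eventually hU).mono fun k hk => ⟨y, hy, hk⟩))

end Iterates

/-! ### The common fixed point -/

section Interval

variable {X : Type*} [CompleteLinearOrder X] [MetricSpace X] [OrderTopology X] [DenselyOrdered X]
  {f : X → X}

/-- A point lying in infinitely many images of a set with a non-asymptotic pair. -/
theorem exists_frequently_iterate_eq (hf : Continuous f) {J : Set X} (hJ : IsPreconnected J)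
    (h : ∃ x ∈ J, ∃ y ∈ J, ∃ ε > 0, ∃ᶠ n in atTop, ε < dist (f^[n] x) (f^[n] y)) :
    ∃ c, ∃ᶠ n in atTop, ∃ x ∈ J, f^[n] x = c := by
  obtain ⟨x, hx, y, hy, ε, hε, hxy⟩ := h
  have hcl : IsClosed {q : X × X | ε ≤ dist q.1 q.2} :=
    isClosed_le continuous_const (continuous_fst.dist continuous_snd)
  -- Any `c` strictly between the coordinates of a cluster point off the diagonal is straddled by
  -- the two orbits infinitely often.
  obtain ⟨⟨u, v⟩, huv, hclu⟩ := hcl.isCompact.exists_mapClusterPt_of_frequently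
    (f := fun n : ℕ => (f^[n] x, f^[n] y)) (hxy.mono fun n hn => hn.le)
  have hne : u ≠ v := by
    rintro rfl
    simp only [Set.mem_ofPred_eq, dist_self] at huv
    linarith
  have hoc : ∀ n, (f^[n] '' J).OrdConnected := fun n =>
    (hJ.image _ (hf.iterate n).continuousOn).ordConnected
  rcases lt_or_gt_of_ne hne with h | h
  · obtain ⟨c, huc, hcv⟩ := exists_between h
    refine ⟨c, (hclu.frequently (prod_mem_nhds (Iio_mem_nhds huc) (Ioi_mem_nhds hcv))).mono ?_⟩
    rintro n ⟨h1, h2⟩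
    exact (hoc n).out ⟨x, hx, rfl⟩ ⟨y, hy, rfl⟩ ⟨le_of_lt h1, le_of_lt h2⟩
  · obtain ⟨c, hvc, hcu⟩ := exists_between h
    refine ⟨c, (hclu.frequently (prod_mem_nhds (Ioi_mem_nhds hcu) (Iio_mem_nhds hvc))).mono ?_⟩
    rintro n ⟨h1, h2⟩
    exact (hoc n).out ⟨y, hy, rfl⟩ ⟨x, hx, rfl⟩ ⟨le_of_lt h2, le_of_lt h1⟩

/-- If `y` were a gap, late images would lie wholly on one side of `y`. Images at times differing by
some `p` meet, so the side is `p`-periodic, and both sides occur. A proximal pair taken from a left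
and a right image comes close at multiples of `p`, across the gap. -/
theorem ordConnected_returnSet (hf : Continuous f)
    (hprox : ∀ J K : Set X, IsPreconnected J → J.Nontrivial → IsPreconnected K → K.Nontrivial →
      ∃ x ∈ J, ∃ y ∈ K, ∀ ε > 0, ∃ᶠ n in atTop, dist (f^[n] x) (f^[n] y) < ε)
    (hsens : ∀ J : Set X, IsPreconnected J → J.Nontrivial →
      ∃ x ∈ J, ∃ y ∈ J, ∃ ε > 0, ∃ᶠ n in atTop, ε < dist (f^[n] x) (f^[n] y))
    {J : Set X} (hJ : IsPreconnected J) (hJn : J.Nontrivial) :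
    (returnSet f J).OrdConnected := by
  refine ⟨fun a ha b hb y hy => ?_⟩
  by_contra hyD
  have hya : a < y := lt_of_le_of_ne hy.1 (by rintro rfl; exact hyD ha)
  have hyb : y < b := lt_of_le_of_ne hy.2 (by rintro rfl; exact hyD hb)
  have hyD' : ∃ U ∈ 𝓝 y, ∀ᶠ n in atTop, ∀ x ∈ J, f^[n] x ∉ U := by
    simpa [returnSet, not_frequently] using hyD
  obtain ⟨U, hU, hev⟩ := hyD'
  obtain ⟨ε, hε, hεU⟩ := Metric.mem_nhds_iff.1 hU
  obtain ⟨N, hN⟩ := eventually_atTop.1 hev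
  have hoc : ∀ n, (f^[n] '' J).OrdConnected := fun n =>
    (hJ.image _ (hf.iterate n).continuousOn).ordConnected
  have hside : ∀ n ≥ N, (∀ x ∈ J, f^[n] x < y) ∨ (∀ x ∈ J, y < f^[n] x) := by
    intro n hn
    by_contra! hcon
    obtain ⟨⟨u, hu, hyu⟩, v, hv, hvy⟩ := hcon
    obtain ⟨w, hw, hwy⟩ := (hoc n).out ⟨v, hv, rfl⟩ ⟨u, hu, rfl⟩ ⟨hvy, hyu⟩
    exact hN n hn w hw (hwy ▸ mem_of_mem_nhds hU)
  have hleft : ∀ n ≥ N, (∃ x ∈ J, f^[n] x < y) → ∀ x ∈ J, f^[n] x < y := by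
    rintro n hn ⟨x, hx, hxy⟩
    exact (hside n hn).resolve_right fun h => (h x hx).not_gt hxy
  have hright : ∀ n ≥ N, (∃ x ∈ J, y < f^[n] x) → ∀ x ∈ J, y < f^[n] x := by
    rintro n hn ⟨x, hx, hxy⟩
    exact (hside n hn).resolve_left fun h => (h x hx).not_gt hxy
  -- the side of `y` on which the images lie is eventually periodic
  obtain ⟨c, hc⟩ := exists_frequently_iterate_eq hf hJ (hsens J hJ hJn)
  obtain ⟨n, hnN, x₁, hx₁, hxc⟩ := (frequently_atTop.1 hc) N
  obtain ⟨n', hn', x₂, hx₂, hxc'⟩ := (frequently_atTop.1 hc) (n + 1)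
  obtain ⟨p, hp, rfl⟩ : ∃ p, 0 < p ∧ n' = n + p := ⟨n' - n, by omega, by omega⟩
  have hmeet : ∀ m ≥ n, f^[m] x₁ = f^[m + p] x₂ := by
    intro m hm
    obtain ⟨j, rfl⟩ := Nat.exists_eq_add_of_le hm
    rw [show n + j = j + n by ring, show j + n + p = j + (n + p) by ring,
      Function.iterate_add_apply, Function.iterate_add_apply f j (n + p), hxc, hxc']
  have hperL : ∀ m ≥ n, (∃ x ∈ J, f^[m] x < y) → ∀ k, ∀ x ∈ J, f^[p * k + m] x < y := by
    intro m hm h k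
    induction k with
    | zero => simpa using hleft m (by omega) h
    | succ k ih =>
      refine hleft _ (by nlinarith) ⟨x₂, hx₂, ?_⟩
      rw [show p * (k + 1) + m = p * k + m + p by ring, ← hmeet _ (by nlinarith)]
      exact ih x₁ hx₁
  have hperR : ∀ m ≥ n, (∃ x ∈ J, y < f^[m] x) → ∀ k, ∀ x ∈ J, y < f^[p * k + m] x := by
    intro m hm h k
    induction k with
    | zero => simpa using hright m (by omega) h
    | succ k ih =>
      refine hright _ (by nlinarith) ⟨x₂, hx₂, ?_⟩
      rw [show p * (k + 1) + m = p * k + m + p by ring, ← hmeet _ (by nlinarith)]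
      exact ih x₁ hx₁
  obtain ⟨m₁, hm₁, hm₁L⟩ := (frequently_atTop.1 (ha _ (Iio_mem_nhds hya))) n
  obtain ⟨m₂, hm₂, hm₂R⟩ := (frequently_atTop.1 (hb _ (Ioi_mem_nhds hyb))) n
  obtain ⟨_, ⟨u, hu, rfl⟩, _, ⟨v, hv, rfl⟩, huv⟩ := hprox (f^[m₁] '' J) (f^[m₂] '' J)
    (hJ.image _ (hf.iterate m₁).continuousOn) (image_iterate_nontrivial (hsens J hJ hJn) m₁)
    (hJ.image _ (hf.iterate m₂).continuousOn) (image_iterate_nontrivial (hsens J hJ hJn) m₂)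
  -- a short segment straddling `y` cannot exist
  have hsmall : ∃ η > 0, ∀ s t, s < y → y < t → s ∉ Metric.ball y ε → t ∉ Metric.ball y ε →
      η ≤ dist s t := by
    -- The metric need not be monotone in the order, so the bound `η` comes from compactness:
    -- distance zero would force both points to be `y`.
    have hK : IsCompact ({s | s ≤ y ∧ s ∉ Metric.ball y ε} ×ˢ {t | y ≤ t ∧ t ∉ Metric.ball y ε} :
        Set (X × X)) := by
      refine IsClosed.isCompact (IsClosed.prod ?_ ?_)
      · exact isClosed_Iic.inter Metric.isOpen_ball.isClosed_compl
      · exact isClosed_Ici.inter Metric.isOpen_ball.isClosed_compl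
    rcases Set.eq_empty_or_nonempty ({s | s ≤ y ∧ s ∉ Metric.ball y ε} ×ˢ
      {t | y ≤ t ∧ t ∉ Metric.ball y ε} : Set (X × X)) with he | hne
    · refine ⟨1, one_pos, fun s t h1 h2 h3 h4 => ?_⟩
      have : (s, t) ∈ (∅ : Set (X × X)) := he ▸ ⟨⟨h1.le, h3⟩, ⟨h2.le, h4⟩⟩
      exact this.elim
    · obtain ⟨⟨s₀, t₀⟩, ⟨⟨h1, h2⟩, h3, h4⟩, hmin⟩ :=
        hK.exists_isMinOn hne (continuous_fst.dist continuous_snd).continuousOn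
      refine ⟨dist s₀ t₀, dist_pos.2 ?_, fun s t a1 a2 a3 a4 =>
        hmin (show (s, t) ∈ _ from ⟨⟨a1.le, a3⟩, ⟨a2.le, a4⟩⟩)⟩
      rintro rfl
      have : s₀ = y := le_antisymm h1 h3
      exact h2 (this ▸ Metric.mem_ball_self hε)
  obtain ⟨η, hη, hηd⟩ := hsmall
  obtain ⟨k, hk⟩ := (frequently_dist_iterate_mul_lt hf huv hp hη).exists
  rw [← Function.iterate_add_apply, ← Function.iterate_add_apply] at hk
  refine hk.not_ge (hηd _ _ (hperL m₁ hm₁ hm₁L k u hu) (hperR m₂ hm₂ hm₂R k v hv) ?_ ?_)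
  · exact fun h => hN _ (by nlinarith) u hu (hεU h)
  · exact fun h => hN _ (by nlinarith) v hv (hεU h)

/-- There is a fixed point to which all nondegenerate intervals return. -/
theorem exists_fixedPt_mem_returnSet
    (hf : Continuous f)
    (hprox : ∀ J K : Set X, IsPreconnected J → J.Nontrivial → IsPreconnected K → K.Nontrivial →
      ∃ x ∈ J, ∃ y ∈ K, ∀ ε > 0, ∃ᶠ n in atTop, dist (f^[n] x) (f^[n] y) < ε)
    (hsens : ∀ J : Set X, IsPreconnected J → J.Nontrivial →
      ∃ x ∈ J, ∃ y ∈ J, ∃ ε > 0, ∃ᶠ n in atTop, ε < dist (f^[n] x) (f^[n] y)) :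
    ∃ z, f z = z ∧ ∀ J : Set X, IsPreconnected J → J.Nontrivial → z ∈ returnSet f J := by
  let ι := {J : Set X // IsPreconnected J ∧ J.Nontrivial}
  let D : ι → Set X := fun J => returnSet f J.1
  have hint : ∀ J K : ι, (D J ∩ D K).Nonempty := fun J K =>
    returnSet_inter_nonempty (hprox J.1 K.1 J.2.1 J.2.2 K.2.1 K.2.2)
  have hne : ∀ J, (D J).Nonempty := fun J => (hint J J).mono Set.inter_subset_left
  have hc : ∀ J, IsCompact (D J) := fun J => (isClosed_returnSet f J.1).isCompact
  have hoc : ∀ J, (D J).OrdConnected := fun J =>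
    ordConnected_returnSet hf hprox hsens J.2.1 J.2.2
  -- Helly's theorem in dimension one: pairwise intersections put every left end below every right
  -- end.
  have hle : ∀ J K, sInf (D J) ≤ sSup (D K) := by
    intro J K
    obtain ⟨x, hxJ, hxK⟩ := hint J K
    exact (sInf_le hxJ).trans (le_sSup hxK)
  have hsub : ∀ J, ∀ x ∈ Set.Icc (⨆ J, sInf (D J)) (⨅ J, sSup (D J)), x ∈ D J := by
    intro J x hx
    exact (hoc J).out ((hc J).sInf_mem (hne J)) ((hc J).sSup_mem (hne J))
      ⟨(le_iSup (fun J => sInf (D J)) J).trans hx.1,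
        hx.2.trans (iInf_le (fun J => sSup (D J)) J)⟩
  obtain ⟨z, hz, hfz⟩ := exists_mem_Icc_isFixedPt_of_mapsTo (f := f) hf.continuousOn
    (iSup_le fun J => le_iInf fun K => hle J K : (⨆ J, sInf (D J)) ≤ ⨅ J, sSup (D J))
    (fun x hx => ⟨iSup_le fun J => sInf_le (mapsTo_returnSet hf J.1 (hsub J x hx)),
      le_iInf fun J => le_sSup (mapsTo_returnSet hf J.1 (hsub J x hx))⟩)
  exact ⟨z, hfz, fun J hJ hJn => hsub ⟨J, hJ, hJn⟩ z hz⟩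

theorem exists_fixedPt_eventually_mem_nhds
    (hf : Continuous f)
    (hprox : ∀ J K : Set X, IsPreconnected J → J.Nontrivial → IsPreconnected K → K.Nontrivial →
      ∃ x ∈ J, ∃ y ∈ K, ∀ ε > 0, ∃ᶠ n in atTop, dist (f^[n] x) (f^[n] y) < ε)
    (hsens : ∀ J : Set X, IsPreconnected J → J.Nontrivial →
      ∃ x ∈ J, ∃ y ∈ J, ∃ ε > 0, ∃ᶠ n in atTop, ε < dist (f^[n] x) (f^[n] y)) :
    ∃ z, f z = z ∧ ∀ J : Set X, IsPreconnected J → J.Nontrivial → ∀ U ∈ 𝓝 z,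
      ∀ᶠ n in atTop, ∃ x ∈ J, f^[n] x ∈ U := by
  obtain ⟨z, hz, hzr⟩ := exists_fixedPt_mem_returnSet hf hprox hsens
  refine ⟨z, hz, fun J hJ hJn U hU => eventually_exists_iterate_mem_nhds hf hz
    (fun J hJ hJn => hzr J hJ hJn)
    (fun J hJ hJn => image_iterate_nontrivial (hsens J hJ hJn)) (fun J hJ hJn => ?_) hJ hJn hU⟩
  obtain ⟨c, hc⟩ := exists_frequently_iterate_eq hf hJ (hsens J hJ hJn)
  obtain ⟨n, x, hx, hxc⟩ := hc.exists
  obtain ⟨m, hm, y, hy, hyc⟩ := (frequently_atTop.1 hc) (n + 1)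
  refine ⟨n, m - n, by omega, x, hx, y, hy, ?_⟩
  rw [hxc, show n + (m - n) = m by omega, hyc]

end Interval

/-! ### Baire category and a pigeonhole estimate -/

section Baire

/-- A Baire category argument localized to an open set. -/
theorem exists_mem_forall_mem_of_isOpen {Y κ : Type*} [TopologicalSpace Y] [BaireSpace Y]
    [Countable κ] {O : Set Y} (hO : IsOpen O) (hOn : O.Nonempty) {W : κ → Set Y}
    (hW : ∀ k, IsOpen (W k))
    (hd : ∀ k, ∀ V ⊆ O, IsOpen V → V.Nonempty → (V ∩ W k).Nonempty) :
    ∃ y ∈ O, ∀ k, y ∈ W k := by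
  have hdense : Dense (⋂ k, W k ∪ (closure O)ᶜ) := by
    refine dense_iInter_of_isOpen (fun k => (hW k).union isClosed_closure.isOpen_compl) fun k => ?_
    rw [dense_iff_inter_open]
    intro U hU hUn
    by_cases h : (U ∩ O).Nonempty
    · obtain ⟨y, ⟨hyU, -⟩, hyW⟩ := hd k _ Set.inter_subset_right (hU.inter hO) h
      exact ⟨y, hyU, Or.inl hyW⟩
    · obtain ⟨y, hy⟩ := hUn
      have hdis : Disjoint U (closure O) :=
        (Set.disjoint_iff_inter_eq_empty.2 (Set.not_nonempty_iff_eq_empty.1 h)).closure_right hU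
      exact ⟨y, hy, Or.inr (hdis.notMem_of_mem_left hy)⟩
  obtain ⟨y, hyO, hy⟩ := hdense.inter_open_nonempty O hO hOn
  exact ⟨y, hyO, fun k => (Set.mem_iInter.1 hy k).resolve_right fun h => h (subset_closure hyO)⟩

/-- A connected set of diameter at least `δ` contains a point away from any `card σ` given
points. -/
theorem IsPreconnected.exists_forall_lt_dist {Y σ : Type*} [PseudoMetricSpace Y] [Fintype σ]
    {S : Set Y} (hS : IsPreconnected S) {u v : Y} (hu : u ∈ S) (hv : v ∈ S) {δ : ℝ} (hδ : 0 < δ)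
    (huv : δ ≤ dist u v) (w : σ → Y) :
    ∃ c ∈ S, ∀ j, δ / (3 * (Fintype.card σ + 1)) < dist c (w j) := by
  set m : ℝ := (Fintype.card σ : ℝ) + 1 with hm
  have hm0 : 0 < m := by positivity
  by_contra! hcon
  have hIcc : Set.Icc (dist u u) (dist u v) ⊆ (fun t => dist u t) '' S :=
    hS.intermediate_value hu hv (continuous_const.dist continuous_id).continuousOn
  -- These `card σ + 1` points are pairwise at least `δ / m` apart, whereas two of them near the
  -- same `w j` would be within `2δ / (3m)`.
  have hc : ∀ i : Fin (Fintype.card σ + 1), ∃ c ∈ S, dist u c = i * (δ / m) := by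
    intro i
    refine hIcc ⟨by rw [dist_self]; positivity, le_trans ?_ huv⟩
    have hi : (i : ℝ) ≤ m := by
      have : ((i : ℕ) : ℝ) ≤ ((Fintype.card σ + 1 : ℕ) : ℝ) := by exact_mod_cast i.2.le
      push_cast at this
      exact this
    calc (i : ℝ) * (δ / m) ≤ m * (δ / m) := by gcongr
      _ = δ := by field_simp
  choose c hcS hcd using hc
  choose j hj using fun i => hcon (c i) (hcS i)
  obtain ⟨i, i', hne, hij⟩ := Fintype.exists_ne_map_eq_of_card_lt j (by simp)
  have h1 : dist (c i) (c i') ≤ 2 * (δ / (3 * m)) := by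
    have h3 := hj i'
    rw [← hij, dist_comm] at h3
    linarith [dist_triangle (c i) (w (j i)) (c i'), hj i]
  have h2 : |(i : ℝ) * (δ / m) - i' * (δ / m)| ≤ dist (c i) (c i') := by
    rw [← hcd, ← hcd, dist_comm u, dist_comm u]
    exact abs_dist_sub_le _ _ _
  have h3 : (1 : ℝ) ≤ |(i : ℝ) - i'| := by
    have : (1 : ℤ) ≤ |((i : ℕ) : ℤ) - (i' : ℕ)| :=
      Int.one_le_abs (sub_ne_zero.2 fun h => hne (Fin.ext (by exact_mod_cast h)))
    exact_mod_cast this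
  rw [← sub_mul, abs_mul, abs_of_pos (div_pos hδ hm0)] at h2
  have h4 : δ / (3 * m) = (δ / m) / 3 := by field_simp
  have h5 : 0 < δ / m := div_pos hδ hm0
  nlinarith

end Baire

/-! ### Generic tuples and asymptotic points -/

section GenericTuples

variable {X : Type*} [CompleteLinearOrder X] [MetricSpace X] [OrderTopology X] [DenselyOrdered X]

theorem IsOpen.exists_isOpen_isPreconnected_nontrivial_subset [Nontrivial X] {V : Set X}
    (hV : IsOpen V) (hVn : V.Nonempty) : ∃ J ⊆ V, IsOpen J ∧ IsPreconnected J ∧ J.Nontrivial := by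
  obtain ⟨a, b, hab, h⟩ := hV.exists_Ioo_subset hVn
  exact ⟨_, h, isOpen_Ioo, isPreconnected_Ioo, (Set.Ioo_infinite hab).nontrivial⟩

theorem IsPreconnected.exists_isOpen_subset_of_nontrivial {J : Set X} (hJ : IsPreconnected J)
    (hJn : J.Nontrivial) : ∃ V ⊆ J, IsOpen V ∧ V.Nonempty := by
  obtain ⟨a, ha, b, hb, hab⟩ := hJn.exists_lt
  exact ⟨_, Set.Ioo_subset_Icc_self.trans (hJ.ordConnected.out ha hb), isOpen_Ioo,
    Set.nonempty_Ioo.2 hab⟩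

variable {f : X → X} {z : X}

/-- If the images of all small intervals near the coordinate `i₀` have length at least `δ`
infinitely often, then a generic tuple is proximal to `z` and its `i₀`-th orbit is infinitely often
far from all other ones. -/
theorem exists_proximal_separated_tuple [Nontrivial X] (hf : Continuous f)
    (hz : ∀ J : Set X, IsPreconnected J → J.Nontrivial → ∀ U ∈ 𝓝 z,
      ∀ᶠ n in atTop, ∃ x ∈ J, f^[n] x ∈ U)
    {σ : Type*} [Fintype σ] {O : σ → Set X} (hO : ∀ i, IsOpen (O i)) (hOn : ∀ i, (O i).Nonempty)
    (i₀ : σ) {δ : ℝ} (hδ : 0 < δ)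
    (hlong : ∀ J ⊆ O i₀, IsPreconnected J → J.Nontrivial →
      ∃ᶠ n in atTop, ∃ u ∈ J, ∃ v ∈ J, δ ≤ dist (f^[n] u) (f^[n] v)) :
    ∃ x : σ → X, (∀ i, x i ∈ O i) ∧ (∀ ε > 0, ∃ᶠ n in atTop, ∀ i, dist (f^[n] (x i)) z < ε) ∧
      ∃ r > 0, ∃ᶠ n in atTop, ∀ j ≠ i₀, r < dist (f^[n] (x i₀)) (f^[n] (x j)) := by
  classical
  set r : ℝ := δ / (3 * (Fintype.card σ + 1)) with hr
  have hr0 : 0 < r := by positivity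
  let P : ℕ → Set (σ → X) := fun N =>
    ⋃ n ≥ N, ⋂ i, {x | dist (f^[n] (x i)) z < 1 / ((N : ℝ) + 1)}
  let Q : ℕ → Set (σ → X) := fun N =>
    ⋃ n ≥ N, ⋂ j : {j // j ≠ i₀}, {x | r < dist (f^[n] (x i₀)) (f^[n] (x j))}
  have hPo : ∀ N, IsOpen (P N) := fun N =>
    isOpen_biUnion fun n _ => isOpen_iInter_of_finite fun i =>
      isOpen_lt (((hf.iterate n).comp (continuous_apply i)).dist continuous_const) continuous_const
  have hQo : ∀ N, IsOpen (Q N) := fun N =>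
    isOpen_biUnion fun n _ => isOpen_iInter_of_finite fun j =>
      isOpen_lt continuous_const (((hf.iterate n).comp (continuous_apply i₀)).dist
        ((hf.iterate n).comp (continuous_apply j.1)))
  obtain ⟨x, hxO, hx⟩ := exists_mem_forall_mem_of_isOpen (κ := ℕ ⊕ ℕ) (O := Set.univ.pi O)
    (W := Sum.elim P Q) (isOpen_set_pi Set.finite_univ fun i _ => hO i)
    (Set.univ_pi_nonempty_iff.2 hOn) (by rintro (N | N); exacts [hPo N, hQo N]) (by
      rintro k V hVO hV ⟨y, hy⟩
      obtain ⟨u, hu, huV⟩ := isOpen_pi_iff'.1 hV y hy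
      rcases k with N | N
      · choose J hJu _ hJp hJn using fun i =>
          (hu i).1.exists_isOpen_isPreconnected_nontrivial_subset ⟨_, (hu i).2⟩
        -- Eventual nearness, unlike infinitely many returns, holds for all coordinates at a common
        -- time.
        have hev : ∀ᶠ n in atTop, ∀ i, ∃ x ∈ J i, f^[n] x ∈ Metric.ball z (1 / ((N : ℝ) + 1)) :=
          eventually_all.2 fun i => hz _ (hJp i) (hJn i) _
            (Metric.ball_mem_nhds _ Nat.one_div_pos_of_nat)
        obtain ⟨n, hn, hnN⟩ := (hev.and (eventually_ge_atTop N)).exists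
        choose x hxJ hx using hn
        refine ⟨x, huV fun i _ => hJu i (hxJ i), ?_⟩
        exact Set.mem_biUnion (show n ∈ {n | n ≥ N} from hnN) (Set.mem_iInter.2 hx)
      · obtain ⟨J, hJ, -, hJp, hJn⟩ := ((hu i₀).1.inter
          (hO i₀)).exists_isOpen_isPreconnected_nontrivial_subset
          ⟨_, (hu i₀).2, hVO hy i₀ (Set.mem_univ _)⟩
        obtain ⟨n, hnN, a, ha, b, hb, hab⟩ := (frequently_atTop.1
          (hlong J (hJ.trans Set.inter_subset_right) hJp hJn)) N
        obtain ⟨_, ⟨c, hc, rfl⟩, hcd⟩ :=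
          (hJp.image _ (hf.iterate n).continuousOn).exists_forall_lt_dist ⟨a, ha, rfl⟩
            ⟨b, hb, rfl⟩ hδ hab (fun j => f^[n] (y j))
        -- Only the coordinate `i₀` moves; the other orbits are fixed targets to avoid.
        refine ⟨Function.update y i₀ c, huV fun i _ => ?_, ?_⟩
        · by_cases h : i = i₀
          · subst h
            simpa using (hJ hc).1
          · simpa [h] using (hu i).2
        · refine Set.mem_biUnion (show n ∈ {n | n ≥ N} from hnN) (Set.mem_iInter.2 fun j => ?_)
          simpa [j.2] using hcd j.1)
  refine ⟨x, fun i => hxO i (Set.mem_univ _), fun ε hε => ?_, r, hr0, ?_⟩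
  · rw [frequently_atTop]
    intro N
    obtain ⟨M, hM⟩ := exists_nat_one_div_lt hε
    obtain ⟨n, hn, hxn⟩ := Set.mem_iUnion₂.1 (hx (Sum.inl (max M N)))
    refine ⟨n, (le_max_right _ _).trans hn, fun i => lt_of_lt_of_le (Set.mem_iInter.1 hxn i) ?_⟩
    refine le_trans (one_div_le_one_div_of_le (by positivity) ?_) hM.le
    have : (M : ℝ) ≤ ((max M N : ℕ) : ℝ) := by exact_mod_cast le_max_left M N
    linarith
  · rw [frequently_atTop]
    intro N
    obtain ⟨n, hn, hxn⟩ := Set.mem_iUnion₂.1 (hx (Sum.inr N))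
    exact ⟨n, hn, fun j hj => Set.mem_iInter.1 hxn ⟨j, hj⟩⟩

/-- If the open set `U` contains everywhere small intervals with eventually small images, then it
contains a point asymptotic to `z`. -/
theorem exists_mem_tendsto_iterate
    (hz : ∀ J : Set X, IsPreconnected J → J.Nontrivial → ∀ U ∈ 𝓝 z,
      ∀ᶠ n in atTop, ∃ x ∈ J, f^[n] x ∈ U)
    {U : Set X} (hU : IsOpen U) (hUn : U.Nonempty)
    (hshort : ∀ V ⊆ U, IsOpen V → V.Nonempty → ∀ δ > 0, ∃ J ⊆ V, IsPreconnected J ∧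
      J.Nontrivial ∧ ∀ᶠ n in atTop, ∀ u ∈ J, ∀ v ∈ J, dist (f^[n] u) (f^[n] v) < δ) :
    ∃ x ∈ U, Tendsto (fun n => f^[n] x) atTop (𝓝 z) := by
  let W : ℕ → Set X := fun m => ⋃₀ {V | IsOpen V ∧
    ∀ᶠ n in atTop, ∀ u ∈ V, dist (f^[n] u) z < 1 / ((m : ℝ) + 1)}
  obtain ⟨x, hxU, hx⟩ := exists_mem_forall_mem_of_isOpen hU hUn (W := W)
    (fun m => isOpen_sUnion fun V hV => hV.1) (by
      intro m V hVU hV hVn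
      have hm : (0 : ℝ) < 1 / ((m : ℝ) + 1) := Nat.one_div_pos_of_nat
      obtain ⟨J, hJV, hJp, hJn, hJ⟩ := hshort V hVU hV hVn _ (half_pos hm)
      obtain ⟨V', hV'J, hV'o, x, hx⟩ := hJp.exists_isOpen_subset_of_nontrivial hJn
      refine ⟨x, hJV (hV'J hx), Set.mem_sUnion.2 ⟨V', ⟨hV'o, ?_⟩, hx⟩⟩
      filter_upwards [hJ, hz J hJp hJn _ (Metric.ball_mem_nhds z (half_pos hm))]
        with n hn ⟨y, hy, hyz⟩ u hu
      have h1 := hn u (hV'J hu) y hy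
      have h2 := Metric.mem_ball.1 hyz
      linarith [dist_triangle (f^[n] u) (f^[n] y) z])
  refine ⟨x, hxU, Metric.tendsto_nhds.2 fun ε hε => ?_⟩
  obtain ⟨m, hm⟩ := exists_nat_one_div_lt hε
  obtain ⟨V, ⟨-, hV⟩, hxV⟩ := Set.mem_sUnion.1 (hx m)
  exact hV.mono fun n hn => (hn x hxV).trans hm

end GenericTuples

/-! ### Li–Yorke pairs of finite sets -/

section LiYorke

variable {X : Type*} [MetricSpace X]

/-- The set of values of a finite tuple as a nonempty compact set. -/
def rangeCompacts {ι : Type*} [Finite ι] [Nonempty ι] (x : ι → X) : NonemptyCompacts X :=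
  ⟨⟨Set.range x, (Set.finite_range x).isCompact⟩, Set.range_nonempty x⟩

theorem NonemptyCompacts.dist_le_of_forall_exists {K L : NonemptyCompacts X} {ε : ℝ} (hε : 0 ≤ ε)
    (h₁ : ∀ a ∈ K, ∃ b ∈ L, dist a b ≤ ε) (h₂ : ∀ b ∈ L, ∃ a ∈ K, dist b a ≤ ε) :
    dist K L ≤ ε := by
  rw [Metric.NonemptyCompacts.dist_eq]
  exact Metric.hausdorffDist_le_of_mem_dist hε h₁ h₂

theorem NonemptyCompacts.exists_dist_lt_of_dist_lt {K L : NonemptyCompacts X} {ε : ℝ}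
    (h : dist K L < ε) {a : X} (ha : a ∈ K) : ∃ b ∈ L, dist a b < ε := by
  rw [Metric.NonemptyCompacts.dist_eq] at h
  exact Metric.exists_dist_lt_of_hausdorffDist_lt ha h
    (Metric.hausdorffEDist_ne_top_of_nonempty_of_bounded K.nonempty L.nonempty
      K.isCompact.isBounded L.isCompact.isBounded)

theorem mem_rangeCompacts {ι : Type*} [Finite ι] [Nonempty ι] {x : ι → X} {a : X} :
    a ∈ rangeCompacts x ↔ ∃ i, x i = a := Iff.rfl

/-- A nonempty compact set has a finite net such that all tuples close to it are close to the
compact set. -/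
theorem exists_finite_net (A : NonemptyCompacts X) {ε : ℝ} (hε : 0 < ε) :
    ∃ t : Set X, t.Finite ∧ t.Nonempty ∧ ∃ η > 0, ∀ {κ : Type*} [Finite κ] [Nonempty κ]
      (x : κ → X), (∀ k, ∃ i ∈ t, x k ∈ Metric.ball i η) → (∀ i ∈ t, ∃ k, x k ∈ Metric.ball i η) →
      dist (rangeCompacts x) A < ε := by
  have h3 : 0 < ε / 3 := by positivity
  obtain ⟨t, htA, htf, hcov⟩ := A.isCompact.finite_cover_balls h3
  obtain ⟨a₀, ha₀⟩ := A.nonempty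
  obtain ⟨i₀, hi₀, -⟩ := Set.mem_iUnion₂.1 (hcov ha₀)
  refine ⟨t, htf, ⟨i₀, hi₀⟩, ε / 3, h3, fun {κ} _ _ x h1 h2 => ?_⟩
  refine lt_of_le_of_lt (NonemptyCompacts.dist_le_of_forall_exists (ε := 2 * (ε / 3))
    (by positivity) ?_ ?_) (by linarith)
  · rintro _ ⟨k, rfl⟩
    obtain ⟨i, hi, hk⟩ := h1 k
    exact ⟨i, htA hi, by linarith [Metric.mem_ball.1 hk]⟩
  · intro a ha
    obtain ⟨i, hi, hai⟩ := Set.mem_iUnion₂.1 (hcov ha)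
    obtain ⟨k, hk⟩ := h2 i hi
    refine ⟨x k, ⟨k, rfl⟩, ?_⟩
    have := dist_triangle_right a (x k) i
    linarith [Metric.mem_ball.1 hk, Metric.mem_ball.1 hai]

variable [CompactSpace X]

theorem mem_liYorkePairs_iff {f : C(X, X)} {p : X × X} :
    p ∈ liYorkePairs f ↔ (∀ ε > 0, ∃ᶠ n in atTop, dist (f^[n] p.1) (f^[n] p.2) < ε) ∧
      ∃ ε > 0, ∃ᶠ n in atTop, ε < dist (f^[n] p.1) (f^[n] p.2) := by
  -- Boundedness is what gives the real `liminf` and `limsup` their usual meaning.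
  have hle : IsBoundedUnder (· ≤ ·) atTop (fun n : ℕ => dist (f^[n] p.1) (f^[n] p.2)) :=
    isBoundedUnder_of ⟨_, fun n => Metric.dist_le_diam_of_mem isCompact_univ.isBounded
      (Set.mem_univ _) (Set.mem_univ _)⟩
  have hge : IsBoundedUnder (· ≥ ·) atTop (fun n : ℕ => dist (f^[n] p.1) (f^[n] p.2)) :=
    isBoundedUnder_of ⟨0, fun n => dist_nonneg⟩
  refine and_congr ⟨fun h ε hε => ?_, fun h => ?_⟩ ⟨fun h => ?_, fun ⟨ε, hε, h⟩ => ?_⟩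
  · exact frequently_lt_of_liminf_lt hle.isCoboundedUnder_ge (lt_of_eq_of_lt h hε)
  · refine le_antisymm (le_of_forall_pos_le_add fun ε hε => ?_)
      (le_liminf_of_le hle.isCoboundedUnder_ge (Eventually.of_forall fun n => dist_nonneg))
    rw [zero_add]
    exact liminf_le_of_frequently_le ((h ε hε).mono fun n hn => hn.le) hge
  · obtain ⟨ε, h0, hε⟩ := exists_between (show (0 : ℝ) < _ from h)
    exact ⟨ε, h0, frequently_lt_of_lt_limsup hge.isCoboundedUnder_le hε⟩
  · exact hε.trans_le (le_limsup_of_frequently_le (h.mono fun n hn => hn.le) hle)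

theorem coe_iterate_inducedMap (f : C(X, X)) (n : ℕ) (K : NonemptyCompacts X) :
    (((inducedMap f)^[n] K : NonemptyCompacts X) : Set X) = f^[n] '' K := by
  induction n with
  | zero => simp
  | succ n ih =>
    rw [Function.iterate_succ_apply', Function.iterate_succ', Set.image_comp, ← ih]
    rfl

theorem iterate_inducedMap_rangeCompacts (f : C(X, X)) {ι : Type*} [Finite ι] [Nonempty ι]
    (x : ι → X) (n : ℕ) :
    (inducedMap f)^[n] (rangeCompacts x) = rangeCompacts fun i => f^[n] (x i) := by
  apply NonemptyCompacts.ext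
  rw [coe_iterate_inducedMap]
  exact (Set.range_comp _ _).symm

variable {f : C(X, X)} {z : X} {ι κ : Type*} [Finite ι] [Nonempty ι] [Finite κ] [Nonempty κ]

/-- Two tuples that are simultaneously proximal to `z` and one orbit of which is infinitely often
far from all others form a Li–Yorke pair. -/
theorem rangeCompacts_mem_liYorkePairs_of_separated {x : ι ⊕ κ → X}
    (hprox : ∀ ε > 0, ∃ᶠ n in atTop, ∀ i, dist (f^[n] (x i)) z < ε) {i₀ : ι ⊕ κ} {r : ℝ}
    (hr : 0 < r) (hsep : ∃ᶠ n in atTop, ∀ j ≠ i₀, r < dist (f^[n] (x i₀)) (f^[n] (x j))) :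
    (rangeCompacts (x ∘ Sum.inl), rangeCompacts (x ∘ Sum.inr)) ∈ liYorkePairs (inducedMap f) := by
  rw [mem_liYorkePairs_iff]
  simp only [iterate_inducedMap_rangeCompacts]
  refine ⟨fun ε hε => (hprox (ε / 3) (by positivity)).mono fun n hn => ?_,
    r / 2, half_pos hr, hsep.mono fun n hn => ?_⟩
  · have hd : ∀ i j, dist (f^[n] (x i)) (f^[n] (x j)) ≤ 2 * (ε / 3) := fun i j => by
      linarith [dist_triangle_right (f^[n] (x i)) (f^[n] (x j)) z, hn i, hn j]
    refine lt_of_le_of_lt (NonemptyCompacts.dist_le_of_forall_exists (ε := 2 * (ε / 3))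
      (by positivity) ?_ ?_) (by linarith)
    · rintro _ ⟨k, rfl⟩
      obtain ⟨j⟩ := ‹Nonempty κ›
      exact ⟨_, ⟨j, rfl⟩, hd _ _⟩
    · rintro _ ⟨k, rfl⟩
      obtain ⟨j⟩ := ‹Nonempty ι›
      exact ⟨_, ⟨j, rfl⟩, hd _ _⟩
  · by_contra! hcon
    -- A small Hausdorff distance would give the point `i₀` a close partner in the other set, hence
    -- with a different index.
    rcases i₀ with i₀ | i₀
    · obtain ⟨_, ⟨j, rfl⟩, hj⟩ := NonemptyCompacts.exists_dist_lt_of_dist_lt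
        (hcon.trans_lt (half_lt_self hr)) (mem_rangeCompacts.2 ⟨i₀, rfl⟩)
      exact (hn (Sum.inr j) (by simp)).not_gt hj
    · rw [dist_comm] at hcon
      obtain ⟨_, ⟨j, rfl⟩, hj⟩ := NonemptyCompacts.exists_dist_lt_of_dist_lt
        (hcon.trans_lt (half_lt_self hr)) (mem_rangeCompacts.2 ⟨i₀, rfl⟩)
      exact (hn (Sum.inl j) (by simp)).not_gt hj

/-- Adding finitely many points asymptotic to `z` to both members of a Li–Yorke pair of points
gives a Li–Yorke pair of compact sets. -/
theorem rangeCompacts_mem_liYorkePairs_of_tendsto {x : Option ι → X} {y : Option κ → X}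
    (hxy : (x none, y none) ∈ liYorkePairs f)
    (hx : ∀ i, Tendsto (fun n => f^[n] (x (some i))) atTop (𝓝 z))
    (hy : ∀ j, Tendsto (fun n => f^[n] (y (some j))) atTop (𝓝 z)) :
    (rangeCompacts x, rangeCompacts y) ∈ liYorkePairs (inducedMap f) := by
  rw [mem_liYorkePairs_iff] at hxy ⊢
  obtain ⟨hprox, r, hr, hsep⟩ := hxy
  simp only [iterate_inducedMap_rangeCompacts]
  have hev : ∀ ε > 0, ∀ᶠ n in atTop, (∀ i, dist (f^[n] (x (some i))) z < ε) ∧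
      ∀ j, dist (f^[n] (y (some j))) z < ε := fun ε hε =>
    (eventually_all.2 fun i => Metric.tendsto_nhds.1 (hx i) ε hε).and
      (eventually_all.2 fun j => Metric.tendsto_nhds.1 (hy j) ε hε)
  refine ⟨fun ε hε => ?_, r / 5, by positivity, ?_⟩
  · have h3 : 0 < ε / 3 := by positivity
    refine ((hprox (ε / 3) h3).and_eventually (hev _ h3)).mono ?_
    rintro n ⟨h0, h1, h2⟩
    refine lt_of_le_of_lt (NonemptyCompacts.dist_le_of_forall_exists (ε := 2 * (ε / 3))
      (by positivity) ?_ ?_) (by linarith)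
    · rintro _ ⟨_ | i, rfl⟩
      · exact ⟨_, ⟨none, rfl⟩, by linarith⟩
      · obtain ⟨j⟩ := ‹Nonempty κ›
        refine ⟨_, ⟨some j, rfl⟩, ?_⟩
        linarith [dist_triangle_right (f^[n] (x (some i))) (f^[n] (y (some j))) z, h1 i, h2 j]
    · rintro _ ⟨_ | j, rfl⟩
      · exact ⟨_, ⟨none, rfl⟩, by rw [dist_comm]; linarith⟩
      · obtain ⟨i⟩ := ‹Nonempty ι›
        refine ⟨_, ⟨some i, rfl⟩, ?_⟩
        linarith [dist_triangle_right (f^[n] (y (some j))) (f^[n] (x (some i))) z, h1 i, h2 j]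
  · refine (hsep.and_eventually (hev (r / 4) (by positivity))).mono ?_
    rintro n ⟨h0, h1, h2⟩
    dsimp only at h0
    by_contra! hcon
    -- Each special point is then near the other one, which is excluded, or near an asymptotic
    -- point, hence within `r / 2` of `z`; both being so contradicts their distance exceeding `r`.
    have hcon' : dist (rangeCompacts fun i => f^[n] (x i)) (rangeCompacts fun j => f^[n] (y j)) <
      r / 4 := by linarith
    have hxn : dist (f^[n] (x none)) z < r / 2 := by
      obtain ⟨_, ⟨_ | j, rfl⟩, hj⟩ := NonemptyCompacts.exists_dist_lt_of_dist_lt hcon'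
        (mem_rangeCompacts.2 ⟨none, rfl⟩)
      · linarith
      · linarith [dist_triangle (f^[n] (x none)) (f^[n] (y (some j))) z, h2 j]
    have hyn : dist (f^[n] (y none)) z < r / 2 := by
      rw [dist_comm] at hcon'
      obtain ⟨_, ⟨_ | i, rfl⟩, hi⟩ := NonemptyCompacts.exists_dist_lt_of_dist_lt hcon'
        (mem_rangeCompacts.2 ⟨none, rfl⟩)
      · rw [dist_comm] at hi
        linarith
      · linarith [dist_triangle (f^[n] (y none)) (f^[n] (x (some i))) z, h1 i]
    linarith [dist_triangle_right (f^[n] (x none)) (f^[n] (y none)) z]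

end LiYorke

/-! ### The dichotomy on finite nets -/

section Main

variable {X : Type*} [CompleteLinearOrder X] [MetricSpace X] [OrderTopology X] [DenselyOrdered X]
  [Nontrivial X]

theorem DenselyChaotic.inducedMap {f : C(X, X)} (hf : DenselyChaotic f) :
    DenselyChaotic (inducedMap f) := by
  have hpair : ∀ J K : Set X, IsPreconnected J → J.Nontrivial → IsPreconnected K →
      K.Nontrivial → ∃ x ∈ J, ∃ y ∈ K, (x, y) ∈ liYorkePairs f := by
    intro J K hJ hJn hK hKn
    obtain ⟨V, hVJ, hVo, hVn⟩ := hJ.exists_isOpen_subset_of_nontrivial hJn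
    obtain ⟨V', hVK, hVo', hVn'⟩ := hK.exists_isOpen_subset_of_nontrivial hKn
    obtain ⟨⟨x, y⟩, ⟨hx, hy⟩, hxy⟩ :=
      hf.inter_open_nonempty _ (hVo.prod hVo') (hVn.prod hVn')
    exact ⟨x, hVJ hx, y, hVK hy, hxy⟩
  obtain ⟨z, -, hz⟩ := exists_fixedPt_eventually_mem_nhds f.continuous
    (fun J K hJ hJn hK hKn =>
      let ⟨x, hx, y, hy, h⟩ := hpair J K hJ hJn hK hKn
      ⟨x, hx, y, hy, (mem_liYorkePairs_iff.1 h).1⟩)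
    (fun J hJ hJn =>
      let ⟨x, hx, y, hy, h⟩ := hpair J J hJ hJn hJ hJn
      ⟨x, hx, y, hy, (mem_liYorkePairs_iff.1 h).2⟩)
  refine Metric.dense_iff.2 ?_
  rintro ⟨A, B⟩ ε hε
  obtain ⟨s, hsf, hsn, η, hη, hs⟩ := exists_finite_net A hε
  obtain ⟨t, htf, htn, θ, hθ, ht⟩ := exists_finite_net B hε
  have := hsf.fintype
  have := htf.fintype
  have := hsn.to_subtype
  have := htn.to_subtype
  let O : s ⊕ t → Set X := Sum.elim (fun i => Metric.ball i.1 η) (fun j => Metric.ball j.1 θ)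
  have hO : ∀ i, IsOpen (O i) := by
    rintro (i | i) <;> exact Metric.isOpen_ball
  have hOn : ∀ i, (O i).Nonempty := by
    rintro (i | i)
    exacts [⟨i.1, Metric.mem_ball_self hη⟩, ⟨i.1, Metric.mem_ball_self hθ⟩]
  by_cases hlong : ∃ i₀, ∃ V ⊆ O i₀, IsOpen V ∧ V.Nonempty ∧ ∃ δ > 0,
      ∀ J ⊆ V, IsPreconnected J → J.Nontrivial →
        ∃ᶠ n in atTop, ∃ u ∈ J, ∃ v ∈ J, δ ≤ dist (f^[n] u) (f^[n] v)
  · classical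
    obtain ⟨i₀, V, hVO, hVo, hVn, δ, hδ, hJ⟩ := hlong
    obtain ⟨x, hxO, hprox, r, hr, hsep⟩ := exists_proximal_separated_tuple f.continuous hz
      (O := Function.update O i₀ V)
      (fun i => by by_cases h : i = i₀ <;> [(subst h; simpa); simpa [h] using hO i])
      (fun i => by by_cases h : i = i₀ <;> [(subst h; simpa); simpa [h] using hOn i])
      i₀ hδ (by simpa using hJ)
    have hx : ∀ i, x i ∈ O i := by
      intro i
      have := hxO i
      by_cases h : i = i₀
      · subst h
        exact hVO (by simpa using this)
      · simpa [h] using this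
    refine ⟨_, ?_, rangeCompacts_mem_liYorkePairs_of_separated hprox hr hsep⟩
    refine max_lt (hs _ (fun k => ⟨k.1, k.2, hx (Sum.inl k)⟩) fun i hi => ⟨⟨i, hi⟩, hx (Sum.inl _)⟩)
      (ht _ (fun k => ⟨k.1, k.2, hx (Sum.inr k)⟩) fun i hi => ⟨⟨i, hi⟩, hx (Sum.inr _)⟩)
  · push Not at hlong
    have hasymp : ∀ i, ∃ x ∈ O i, Tendsto (fun n => f^[n] x) atTop (𝓝 z) := fun i =>
      exists_mem_tendsto_iterate hz (hO i) (hOn i) fun V hVO hV hVn δ hδ => by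
        simpa only [not_frequently, not_exists, not_and, not_le] using
          hlong i V hVO hV hVn δ hδ
    choose w hwO hw using hasymp
    obtain ⟨i₁⟩ := ‹Nonempty s›
    obtain ⟨j₁⟩ := ‹Nonempty t›
    -- The asymptotic points already fill the nets, so `a` and `b` need only lie in one ball each.
    obtain ⟨⟨a, b⟩, ⟨ha, hb⟩, hab⟩ := hf.inter_open_nonempty (O (Sum.inl i₁) ×ˢ O (Sum.inr j₁))
      ((hO _).prod (hO _)) ((hOn _).prod (hOn _))
    refine ⟨(rangeCompacts fun k : Option s => k.elim a (w ∘ Sum.inl),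
      rangeCompacts fun k : Option t => k.elim b (w ∘ Sum.inr)), ?_,
      rangeCompacts_mem_liYorkePairs_of_tendsto hab (fun i => hw (Sum.inl i))
        fun j => hw (Sum.inr j)⟩
    refine max_lt (hs _ ?_ fun i hi => ⟨some ⟨i, hi⟩, hwO (Sum.inl _)⟩)
      (ht _ ?_ fun i hi => ⟨some ⟨i, hi⟩, hwO (Sum.inr _)⟩)
    · rintro (_ | k)
      exacts [⟨i₁.1, i₁.2, ha⟩, ⟨k.1, k.2, hwO (Sum.inl k)⟩]
    · rintro (_ | k)
      exacts [⟨j₁.1, j₁.2, hb⟩, ⟨k.1, k.2, hwO (Sum.inr k)⟩]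

end Main

theorem theorem4p1 (f : C(unitInterval, unitInterval)) (hf : DenselyChaotic f) :
    DenselyChaotic (inducedMap f) :=
  hf.inducedMap
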